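/- For a finite simple graph $G$ with adjacency matrix $A(G)$, let $S(G)=J-I-2A(G)$ be its Seidel matrix, where $J$ is the all-ones matrix; the Seidel spectrum of $G$ is the multiset of eigenvalues of $S(G)$. Switching $G$ with respect to a set $U$ of vertices deletes all edges between $U$ and its complement and adds all edges between $U$ and its complement that were not present in $G$; two graphs on the same vertex set are switching equivalent if one arises from the other by such a switching. A graph $G$ is called $S$-determined if every finite simple graph with the same Seidel spectrum as $G$ is switching equivalent to a graph isomorphic to $G$. Theorem. Let $n_1,\ldots,n_s\ge 1$ and $r_1,\ldots,r_s\ge 0$ be integers such that $r_i\ge 3$ for some $i$. Then the complete multipartite graph $K_{r_1\cdot n_1,\ldots,r_s\cdot n_s}$, which has $r_i$ parts of size $n_i$ for each $i=1,\ldots,s$ (and in which two vertices are adjacent if and only if they lie in different parts), is $S$-determined. -/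

import Mathlib

universe v

namespace SimpleGraph

open Classical in
/-- The Seidel matrix `S(G) = J - I - 2 A(G)`, with `J` the all-ones matrix. -/
noncomputable def seidelMatrix {V : Type*} (G : SimpleGraph V) : Matrix V V ℝ :=
  Matrix.of (fun _ _ => (1 : ℝ)) - 1 - (2 : ℝ) • G.adjMatrix ℝ

open Classical in
/-- The Seidel characteristic polynomial `det (X I - S(G))`. -/
noncomputable def seidelCharpoly {V : Type*} [Fintype V] (G : SimpleGraph V) : Polynomial ℝ :=
  G.seidelMatrix.charpoly

/-- The Seidel spectrum: the multiset of roots of the Seidel characteristic polynomial.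
The Seidel matrix is real symmetric, so all its eigenvalues are real. -/
noncomputable def seidelSpectrum {V : Type*} [Fintype V] (G : SimpleGraph V) : Multiset ℝ :=
  G.seidelCharpoly.roots

/-- Seidel switching with respect to `U`: adjacency is kept for pairs on the same side of the
partition `U`, `Uᶜ`, and complemented for pairs on different sides. -/
def seidelSwitch {V : Type*} (G : SimpleGraph V) (U : Set V) : SimpleGraph V where
  Adj v w := ((v ∈ U ↔ w ∈ U) ∧ G.Adj v w) ∨ (¬(v ∈ U ↔ w ∈ U) ∧ ¬G.Adj v w)
  symm := ⟨fun v w h => by rwa [G.adj_comm w v, iff_comm (a := w ∈ U)]⟩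
  loopless := ⟨fun v h => by simp at h⟩

/-- Two graphs on the same vertex set are switching equivalent if one is obtained from the other
by a Seidel switching. -/
def SwitchingEquivalent {V : Type*} (G H : SimpleGraph V) : Prop :=
  ∃ U : Set V, G.seidelSwitch U = H

/-- `G` is `S`-determined: every finite graph with the same Seidel spectrum as `G` is switching
equivalent to a graph isomorphic to `G`. -/
def SDetermined.{a, b} {V : Type a} [Fintype V] (G : SimpleGraph V) : Prop :=
  ∀ (W : Type b) [Fintype W] (H : SimpleGraph W), H.seidelSpectrum = G.seidelSpectrum →
    ∃ G' : SimpleGraph W, H.SwitchingEquivalent G' ∧ Nonempty (G' ≃g G)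

/-- The complete multipartite graph `K_{r₁·n₁, …, r_s·n_s}`, with `r i` parts of size `n i` for
each `i`. The parts are indexed by the pairs `⟨i, j⟩` with `j < r i`. -/
abbrev repeatedMultipartiteGraph {s : ℕ} (r n : Fin s → ℕ) :
    SimpleGraph (Σ p : (Σ i : Fin s, Fin (r i)), Fin (n p.1)) :=
  completeMultipartiteGraph fun p : (Σ i : Fin s, Fin (r i)) => Fin (n p.1)

end SimpleGraph

/-! Work with `S + I = J - 2A`, whose spectrum is a shift of the Seidel spectrum and is invariant
under switching. For a complete multipartite graph it is positive semidefinite on the vectors of sum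
zero, so it has at most one negative eigenvalue. Conversely, this inertia condition forces a graph
to be switching equivalent to a complete multipartite one
(`exists_isCompleteMultipartite_seidelSwitch`). It remains to recover the part sizes from the
spectrum.

Let `k` be the number of parts, `dᵢ` twice the part sizes and `Q = ∏ (X - dᵢ)`. Up to a factor 2 and
powers of `X`, the characteristic polynomial is `P = X Q' - (k - 2) Q`. Since `P(0) ≠ 0` when `k ≠
2`, the spectrum determines `k`, and then `Q` up to a term `c X ^ (k - 2)`. Three equal parts give
`Q` a triple root `a`, so `a` is a double root of `P`. A double root of `P` must be a root of any
competing `Q`, because `P / Q = 2 + ∑ dᵢ / (t - dᵢ)` has only simple zeros. Both candidates for `Q`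
thus vanish at `a ≠ 0`, so `c = 0`. -/

namespace SimpleGraph

open Matrix Polynomial

/-! ### The matrix `S + I` and switching -/

section Seidel

open Classical in
/-- The matrix `S(G) + I = J - 2 A(G)`, whose entries are `-1` on edges and `1` elsewhere. -/
noncomputable def signMatrix {V : Type*} (G : SimpleGraph V) : Matrix V V ℝ :=
  Matrix.of fun v w => if G.Adj v w then -1 else 1

variable {V W : Type*}

lemma signMatrix_apply_of_adj {G : SimpleGraph V} {v w : V} (h : G.Adj v w) :
    G.signMatrix v w = -1 := by
  simp [signMatrix, h]

lemma signMatrix_apply_of_not_adj {G : SimpleGraph V} {v w : V} (h : ¬G.Adj v w) :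
    G.signMatrix v w = 1 := by
  simp [signMatrix, h]

lemma signMatrix_isHermitian (G : SimpleGraph V) : G.signMatrix.IsHermitian := by
  ext v w
  by_cases h : G.Adj v w
  · simp [signMatrix, h, h.symm]
  · simp [signMatrix, h, mt (G.adj_symm) h]

lemma charpoly_signMatrix [Fintype V] [DecidableEq V] (G : SimpleGraph V) :
    G.signMatrix.charpoly = G.seidelCharpoly.comp (X - 1) := by
  classical
  have h : G.seidelMatrix = G.signMatrix - scalar V 1 := by
    ext v w
    by_cases hvw : v = w
    · subst hvw
      simp [seidelMatrix, signMatrix]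
    · by_cases ha : G.Adj v w
      · simp [seidelMatrix, signMatrix, hvw, ha]
        norm_num
      · simp [seidelMatrix, signMatrix, hvw, ha]
  have h2 : G.seidelCharpoly = G.signMatrix.charpoly.comp (X + C 1) := by
    rw [← charpoly_sub_scalar, ← h, seidelCharpoly]
    congr!
  rw [h2, comp_assoc]
  simp

open Classical in
lemma monic_seidelCharpoly [Fintype V] (G : SimpleGraph V) : G.seidelCharpoly.Monic :=
  charpoly_monic _

lemma splits_seidelCharpoly [Fintype V] (G : SimpleGraph V) : G.seidelCharpoly.Splits := by
  classical
  have h : G.signMatrix.charpoly.Splits := G.signMatrix_isHermitian.splits_charpoly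
  rw [charpoly_signMatrix] at h
  have := h.comp_X_add_C 1
  simpa [comp_assoc] using this

lemma charpoly_signMatrix_eq_of_seidelSpectrum_eq [Fintype V] [Fintype W] [DecidableEq V]
    [DecidableEq W] {G : SimpleGraph V} {H : SimpleGraph W}
    (h : H.seidelSpectrum = G.seidelSpectrum) :
    H.signMatrix.charpoly = G.signMatrix.charpoly := by
  have : H.seidelCharpoly = G.seidelCharpoly := by
    rw [H.splits_seidelCharpoly.eq_prod_roots_of_monic (monic_seidelCharpoly _),
      G.splits_seidelCharpoly.eq_prod_roots_of_monic (monic_seidelCharpoly _)]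
    exact congrArg (fun m : Multiset ℝ => (m.map (X - C ·)).prod) h
  rw [charpoly_signMatrix, charpoly_signMatrix, this]

/-- Switching conjugates `S + I` by a diagonal matrix of signs, which is its own inverse. -/
lemma charpoly_signMatrix_seidelSwitch [Fintype V] [DecidableEq V] (G : SimpleGraph V)
    (U : Set V) : (G.seidelSwitch U).signMatrix.charpoly = G.signMatrix.charpoly := by
  classical
  let d : V → ℝ := fun v => if v ∈ U then 1 else -1
  have hd : diagonal d * diagonal d = 1 := by
    rw [diagonal_mul_diagonal, ← diagonal_one]
    congr 1
    ext v
    by_cases h : v ∈ U <;> simp [d, h]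
  have h : (G.seidelSwitch U).signMatrix = diagonal d * (G.signMatrix * diagonal d) := by
    ext v w
    rw [diagonal_mul, mul_diagonal]
    by_cases hv : v ∈ U <;> by_cases hw : w ∈ U <;> by_cases ha : G.Adj v w <;>
      simp [signMatrix, seidelSwitch, d, hv, hw, ha]
  rw [h, charpoly_mul_comm, Matrix.mul_assoc, hd, Matrix.mul_one]

lemma charpoly_signMatrix_of_iso [Fintype V] [Fintype W] [DecidableEq V] [DecidableEq W]
    {G : SimpleGraph V} {H : SimpleGraph W} (e : G ≃g H) :
    G.signMatrix.charpoly = H.signMatrix.charpoly := by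
  have : H.signMatrix = reindex e.toEquiv e.toEquiv G.signMatrix := by
    ext v w
    have : G.Adj (e.symm v) (e.symm w) ↔ H.Adj v w := e.symm.map_rel_iff
    by_cases h : H.Adj v w
    · rw [signMatrix_apply_of_adj h]
      exact (signMatrix_apply_of_adj (this.2 h)).symm
    · rw [signMatrix_apply_of_not_adj h]
      exact (signMatrix_apply_of_not_adj (mt this.1 h)).symm
  rw [this, charpoly_reindex]

lemma seidelSwitch_seidelSwitch (G : SimpleGraph V) (U T : Set V) :
    (G.seidelSwitch U).seidelSwitch T = G.seidelSwitch (symmDiff U T) := by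
  ext v w
  by_cases h1 : v ∈ U <;> by_cases h2 : w ∈ U <;> by_cases h3 : v ∈ T <;> by_cases h4 : w ∈ T <;>
    simp [seidelSwitch, Set.mem_symmDiff, h1, h2, h3, h4]

end Seidel

/-! ### Symmetric matrices with at most one negative eigenvalue -/

section Inertia

variable {n : Type*} [Fintype n] [DecidableEq n]

lemma exists_ne_zero_smul_add_smul_eq_zero (a b : ℝ) :
    ∃ α β : ℝ, (α ≠ 0 ∨ β ≠ 0) ∧ α * a + β * b = 0 := by
  by_cases ha : a = 0
  · exact ⟨1, 0, by simp, by simp [ha]⟩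
  · exact ⟨-b, a, Or.inr ha, by ring⟩

/-- Expansion of the quadratic form of a symmetric matrix in an orthonormal eigenbasis. -/
lemma _root_.Matrix.IsHermitian.dotProduct_mulVec_eq_sum {A : Matrix n n ℝ}
    (hA : A.IsHermitian) (x : n → ℝ) :
    x ⬝ᵥ A *ᵥ x =
      ∑ i, hA.eigenvalues i * ((hA.eigenvectorBasis i).ofLp ⬝ᵥ x) ^ 2 := by
  have h1 : x = ∑ i, ((hA.eigenvectorBasis i).ofLp ⬝ᵥ x) • (hA.eigenvectorBasis i).ofLp := by
    have := congrArg WithLp.ofLp (hA.eigenvectorBasis.sum_repr' (WithLp.toLp 2 x)).symm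
    simpa [EuclideanSpace.inner_eq_star_dotProduct,
      dotProduct_comm x] using this
  have h2 : A *ᵥ x = ∑ i, ((hA.eigenvectorBasis i).ofLp ⬝ᵥ x) • hA.eigenvalues i •
      (hA.eigenvectorBasis i).ofLp := by
    conv_lhs => rw [h1]
    rw [mulVec_sum]
    refine Finset.sum_congr rfl fun i _ => ?_
    rw [mulVec_smul, hA.mulVec_eigenvectorBasis]
  rw [h2, dotProduct_sum]
  refine Finset.sum_congr rfl fun i _ => ?_
  rw [dotProduct_smul, dotProduct_smul, dotProduct_comm x]
  simp only [smul_eq_mul]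
  ring

lemma _root_.Matrix.IsHermitian.card_roots_filter_neg {A : Matrix n n ℝ} (hA : A.IsHermitian) :
    (A.charpoly.roots.filter (· < 0)).card =
      (Finset.univ.filter fun i => hA.eigenvalues i < 0).card := by
  rw [hA.roots_charpoly_eq_eigenvalues, Multiset.filter_map, Multiset.card_map]
  rfl

/-- A symmetric matrix that is positive semidefinite on a hyperplane has at most one negative
eigenvalue. -/
lemma _root_.Matrix.IsHermitian.card_roots_filter_neg_le_one {A : Matrix n n ℝ}
    (hA : A.IsHermitian) (u : n → ℝ) (h : ∀ x, u ⬝ᵥ x = 0 → 0 ≤ x ⬝ᵥ A *ᵥ x) :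
    (A.charpoly.roots.filter (· < 0)).card ≤ 1 := by
  rw [hA.card_roots_filter_neg, Finset.card_le_one]
  intro i hi j hj
  simp only [Finset.mem_filter, Finset.mem_univ, true_and] at hi hj
  by_contra hij
  set b := fun i => (hA.eigenvectorBasis i).ofLp with hb
  have hbb : ∀ i j, b i ⬝ᵥ b j = if i = j then 1 else 0 := fun i j => by
    have := orthonormal_iff_ite.1 hA.eigenvectorBasis.orthonormal i j
    rw [EuclideanSpace.inner_eq_star_dotProduct, dotProduct_comm] at this
    simpa using this
  -- Two negative eigenvectors span a negative definite plane, which meets the hyperplane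
  -- nontrivially.
  obtain ⟨α, β, hne, h0⟩ := exists_ne_zero_smul_add_smul_eq_zero (u ⬝ᵥ b i) (u ⬝ᵥ b j)
  have key := h (α • b i + β • b j) (by simpa [dotProduct_add] using h0)
  have hAi : A *ᵥ b i = hA.eigenvalues i • b i := hA.mulVec_eigenvectorBasis i
  have hAj : A *ᵥ b j = hA.eigenvalues j • b j := hA.mulVec_eigenvectorBasis j
  rw [mulVec_add, mulVec_smul, mulVec_smul, hAi, hAj] at key
  simp only [add_dotProduct, dotProduct_add, smul_dotProduct, dotProduct_smul, hbb, hij,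
    Ne.symm hij, if_true, if_false, smul_eq_mul] at key
  rcases hne with h1 | h1
  · nlinarith [sq_nonneg β, mul_self_pos.2 h1]
  · nlinarith [sq_nonneg α, mul_self_pos.2 h1]

/-- A symmetric matrix with at most one negative eigenvalue is not negative definite on any
plane. -/
lemma _root_.Matrix.IsHermitian.exists_nonneg_of_card_roots_le_one {A : Matrix n n ℝ}
    (hA : A.IsHermitian) (h : (A.charpoly.roots.filter (· < 0)).card ≤ 1) (f g : n → ℝ) :
    ∃ α β : ℝ, (α ≠ 0 ∨ β ≠ 0) ∧
      0 ≤ (α • f + β • g) ⬝ᵥ A *ᵥ (α • f + β • g) := by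
  rw [hA.card_roots_filter_neg, Finset.card_le_one] at h
  simp only [Finset.mem_filter, Finset.mem_univ, true_and] at h
  have : ∃ u : n → ℝ, ∀ x, u ⬝ᵥ x = 0 → 0 ≤ x ⬝ᵥ A *ᵥ x := by
    by_cases hn : ∃ i, hA.eigenvalues i < 0
    · obtain ⟨i, hi⟩ := hn
      refine ⟨(hA.eigenvectorBasis i).ofLp, fun x hx => ?_⟩
      rw [hA.dotProduct_mulVec_eq_sum]
      refine Finset.sum_nonneg fun j _ => ?_
      by_cases hj : hA.eigenvalues j < 0
      · rw [h j hj i hi, hx]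
        simp
      · exact mul_nonneg (not_lt.1 hj) (sq_nonneg _)
    · push Not at hn
      refine ⟨0, fun x _ => ?_⟩
      rw [hA.dotProduct_mulVec_eq_sum]
      exact Finset.sum_nonneg fun j _ => mul_nonneg (hn j) (sq_nonneg _)
  obtain ⟨u, hu⟩ := this
  obtain ⟨α, β, hne, h0⟩ := exists_ne_zero_smul_add_smul_eq_zero (u ⬝ᵥ f) (u ⬝ᵥ g)
  exact ⟨α, β, hne, hu _ (by simpa [dotProduct_add] using h0)⟩

end Inertia

/-! ### From the inertia condition to complete multipartite graphs -/

section Switching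

variable {W : Type*}

lemma not_adj_seidelSwitch_neighborSet (H : SimpleGraph W) (a w : W) :
    ¬(H.seidelSwitch (H.neighborSet a)).Adj a w := by
  simp only [seidelSwitch, mem_neighborSet, SimpleGraph.irrefl]
  tauto

/-- If `a` is isolated and `S(H) + I` has at most one negative eigenvalue, then `H` has no induced
subgraph `2K₂`, `P₄` or paw. -/
lemma adj_or_adj_of_card_roots_le_one [Fintype W] [DecidableEq W] {H : SimpleGraph W}
    (hH : (H.signMatrix.charpoly.roots.filter (· < 0)).card ≤ 1) {a : W} (ha : ∀ w, ¬H.Adj a w)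
    {u w v x : W} (huw : H.Adj u w) (hvx : H.Adj v x) : H.Adj v u ∨ H.Adj v w := by
  by_contra! hcon
  obtain ⟨hvu, hvw⟩ := hcon
  let e : W → W → ℝ := fun i => Pi.single i 1
  have he : ∀ i j, e i ⬝ᵥ H.signMatrix *ᵥ e j = H.signMatrix i j := fun i j => by
    simp [e]
  -- Both vectors have coordinate sum zero, thanks to `a`, so only `-2A` contributes. With `p` edges
  -- from `x` to `{u, w}`, the form is `-4(α² + pαβ + 2β²)`, negative definite for `p = 0, 1, 2`
  -- (`2K₂`, `P₄`, paw). Weight 1 on `v` would degenerate at `p = 2`.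
  obtain ⟨α, β, hne, h⟩ := H.signMatrix_isHermitian.exists_nonneg_of_card_roots_le_one hH
    (e u + e w - (2 : ℝ) • e a) ((2 : ℝ) • e v + e x - (3 : ℝ) • e a)
  have hd : ∀ i, H.signMatrix i i = 1 := fun i => signMatrix_apply_of_not_adj (H.irrefl)
  have ha1 : ∀ i, H.signMatrix a i = 1 := fun i => signMatrix_apply_of_not_adj (ha i)
  have ha2 : ∀ i, H.signMatrix i a = 1 := fun i =>
    signMatrix_apply_of_not_adj (fun h => ha i h.symm)
  have hs : ∀ i j, H.signMatrix i j = H.signMatrix j i := fun i j =>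
    H.signMatrix_isHermitian.apply j i
  have hpm : ∀ i j, H.signMatrix i j = 1 ∨ H.signMatrix i j = -1 := fun i j => by
    by_cases hij : H.Adj i j
    · exact Or.inr (signMatrix_apply_of_adj hij)
    · exact Or.inl (signMatrix_apply_of_not_adj hij)
  simp only [mulVec_add, mulVec_sub, mulVec_smul, add_dotProduct, sub_dotProduct, dotProduct_add,
    dotProduct_sub, smul_dotProduct, dotProduct_smul, he, hd, ha1, ha2, smul_eq_mul,
    signMatrix_apply_of_adj huw, signMatrix_apply_of_adj huw.symm,
    signMatrix_apply_of_adj hvx, signMatrix_apply_of_adj hvx.symm,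
    signMatrix_apply_of_not_adj hvu, signMatrix_apply_of_not_adj hvw,
    hs u v, hs w v, hs x u, hs x w] at h
  have hpos : 0 < α ^ 2 ∨ 0 < β ^ 2 := hne.imp (fun h => by positivity) fun h => by positivity
  have h1 := sq_nonneg (α + β)
  have h2 := sq_nonneg (α + 2 * β)
  have h3 := sq_nonneg α
  have h4 := sq_nonneg β
  rcases hpm u x with h5 | h5 <;> rcases hpm w x with h6 | h6 <;> rw [h5, h6] at h <;>
    rcases hpos with h7 | h7 <;> nlinarith

/-- Switching turns the isolated vertices into one part joined to all others. Among the remaining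
vertices the hypothesis makes non-adjacency transitive, since the middle vertex `v` lies on some
edge `vx`. -/
lemma isCompleteMultipartite_seidelSwitch_isolated {H : SimpleGraph W}
    (h : ∀ u w v x, H.Adj u w → H.Adj v x → H.Adj v u ∨ H.Adj v w) :
    (H.seidelSwitch {w | ∀ x, ¬H.Adj w x}).IsCompleteMultipartite := by
  set I : Set W := {w | ∀ x, ¬H.Adj w x} with hI
  have hadj : ∀ p q, ¬(H.seidelSwitch I).Adj p q ↔ ((p ∈ I ↔ q ∈ I) ∧ ¬H.Adj p q) := by
    intro p q
    have h1 : p ∈ I → ¬H.Adj p q := fun hp => hp q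
    have h2 : q ∈ I → ¬H.Adj p q := fun hq hpq => hq p hpq.symm
    simp only [seidelSwitch]
    tauto
  refine ⟨fun u v w huv hvw => ?_⟩
  rw [hadj] at huv hvw ⊢
  refine ⟨huv.1.trans hvw.1, fun huw => ?_⟩
  have hv : v ∉ I := fun hv => huv.1.2 hv w huw
  simp only [hI, Set.mem_ofPred_eq, not_forall, not_not] at hv
  obtain ⟨x, hx⟩ := hv
  exact (h u w v x huw hx).elim (fun h1 => huv.2 h1.symm) hvw.2

/-- A graph whose matrix `S(H) + I` has at most one negative eigenvalue is switching equivalent to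
a complete multipartite graph. -/
lemma exists_isCompleteMultipartite_seidelSwitch [Fintype W] [DecidableEq W] {H : SimpleGraph W}
    (hH : (H.signMatrix.charpoly.roots.filter (· < 0)).card ≤ 1) :
    ∃ U : Set W, (H.seidelSwitch U).IsCompleteMultipartite := by
  cases isEmpty_or_nonempty W
  · exact ⟨∅, ⟨fun u => isEmptyElim u⟩⟩
  · obtain ⟨a⟩ := ‹Nonempty W›
    rw [← H.charpoly_signMatrix_seidelSwitch (H.neighborSet a)] at hH
    refine ⟨symmDiff (H.neighborSet a) {w | ∀ x, ¬(H.seidelSwitch (H.neighborSet a)).Adj w x}, ?_⟩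
    rw [← seidelSwitch_seidelSwitch]
    exact isCompleteMultipartite_seidelSwitch_isolated fun u w v x huw hvx =>
      adj_or_adj_of_card_roots_le_one hH (H.not_adj_seidelSwitch_neighborSet a) huw hvx

end Switching

/-! ### The polynomial `P` and its logarithmic derivative form -/

section MultipartitePoly

variable {ι : Type*} [Fintype ι]

/-- The polynomial `X Q' - (k - 2) Q` for `Q = ∏ (X - dᵢ)` with `k` factors. -/
noncomputable def multipartitePoly (d : ι → ℝ) : ℝ[X] :=
  X * derivative (∏ i, (X - C (d i))) - ((Fintype.card ι : ℝ[X]) - 2) * ∏ i, (X - C (d i))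

lemma eval_multipartitePoly {d : ι → ℝ} {t : ℝ} (ht : ∀ i, t - d i ≠ 0) :
    (multipartitePoly d).eval t = (∏ i, (t - d i)) * (2 + ∑ i, d i / (t - d i)) := by
  classical
  have hder : (derivative (∏ i, (X - C (d i)))).eval t =
      (∏ i, (t - d i)) * ∑ i, (t - d i)⁻¹ := by
    rw [derivative_prod_finset, eval_finsetSum, Finset.mul_sum]
    refine Finset.sum_congr rfl fun i _ => ?_
    rw [← Finset.mul_prod_erase _ _ (Finset.mem_univ i)]
    simp only [derivative_sub, derivative_X, derivative_C, sub_zero, mul_one, eval_prod,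
      eval_sub, eval_X, eval_C]
    rw [mul_comm, inv_mul_cancel_left₀ (ht i)]
  have hsum : ∑ i, d i / (t - d i) = t * (∑ i, (t - d i)⁻¹) - (Fintype.card ι : ℝ) := by
    have : (Fintype.card ι : ℝ) = ∑ _i : ι, (1 : ℝ) := by simp
    rw [this, Finset.mul_sum, ← Finset.sum_sub_distrib]
    refine Finset.sum_congr rfl fun i _ => ?_
    have := ht i
    field_simp
    ring
  rw [hsum, multipartitePoly]
  simp only [eval_mul, eval_sub, eval_ofNat, eval_X, eval_natCast, hder, eval_prod, eval_C]
  ring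

end MultipartitePoly

/-! ### Spectrum of a complete multipartite graph -/

section Multipartite

variable {ι : Type*} [Fintype ι] [DecidableEq ι] (V : ι → Type*)

/-- The vertex-part incidence matrix of a complete multipartite graph. -/
def partMatrix : Matrix (Σ i, V i) ι ℝ := Matrix.of fun v i => if v.1 = i then 1 else 0

/-- Factoring through the parts lets the product be reversed, reducing the characteristic polynomial
to that of a matrix indexed by parts. -/
lemma signMatrix_completeMultipartiteGraph :
    (completeMultipartiteGraph V).signMatrix =
      partMatrix V *
        (Matrix.of fun i v => if v.1 = i then 1 else -1 : Matrix ι (Σ i, V i) ℝ) := by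
  ext v w
  by_cases h : w.1 = v.1
  · rw [signMatrix_apply_of_not_adj (by simp [h])]
    rw [Matrix.mul_apply, Finset.sum_eq_single v.1 (by intro b _ hb; simp [partMatrix, hb.symm])
      (by simp)]
    simp [partMatrix, h]
  · rw [signMatrix_apply_of_adj (by simpa using Ne.symm h)]
    rw [Matrix.mul_apply, Finset.sum_eq_single v.1 (by intro b _ hb; simp [partMatrix, hb.symm])
      (by simp)]
    simp [partMatrix, h]

variable [∀ i, Fintype (V i)]

/-- On vectors of sum zero the quadratic form is twice the sum of the squared part sums. -/
lemma card_roots_signMatrix_completeMultipartiteGraph [DecidableEq (Σ i, V i)] :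
    ((completeMultipartiteGraph V).signMatrix.charpoly.roots.filter (· < 0)).card ≤ 1 := by
  refine (signMatrix_isHermitian _).card_roots_filter_neg_le_one 1 fun x hx => ?_
  rw [one_dotProduct] at hx
  have h : (completeMultipartiteGraph V).signMatrix *ᵥ x =
      fun v => 2 * ∑ y : V v.1, x ⟨v.1, y⟩ := by
    ext v
    have : ∀ w, (completeMultipartiteGraph V).signMatrix v w * x w =
        2 * (if w.1 = v.1 then x w else 0) - x w := fun w => by
      by_cases h : w.1 = v.1
      · rw [signMatrix_apply_of_not_adj (by simp [h]), if_pos h]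
        ring
      · rw [signMatrix_apply_of_adj (by simpa using Ne.symm h), if_neg h]
        ring
    simp only [mulVec, dotProduct, this]
    rw [Finset.sum_sub_distrib, hx, ← Finset.mul_sum, Fintype.sum_sigma, sub_zero]
    congr 1
    rw [Finset.sum_eq_single v.1 (by intro b _ hb; simp [hb]) (by simp)]
    simp
  rw [h, dotProduct, Fintype.sum_sigma]
  refine Finset.sum_nonneg fun i _ => ?_
  change 0 ≤ ∑ y : V i, x ⟨i, y⟩ * (2 * ∑ z : V i, x ⟨i, z⟩)
  rw [← Finset.sum_mul]
  nlinarith [mul_self_nonneg (∑ y : V i, x ⟨i, y⟩)]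

/-- The quotient matrix of `S + I` for the partition of a complete multipartite graph. -/
lemma charpoly_quotient (d : ι → ℝ) :
    2 * (Matrix.of fun i j => if j = i then d j / 2 else -(d j / 2) : Matrix ι ι ℝ).charpoly =
      multipartitePoly d := by
  have hinf : (Set.univ \ Set.range d).Infinite :=
    Set.infinite_univ.sdiff (Set.finite_range d)
  refine eq_of_infinite_eval_eq _ _ (hinf.mono ?_)
  rintro t ⟨-, ht⟩
  have ht' : ∀ i, t - d i ≠ 0 := fun i h => ht ⟨i, (sub_eq_zero.1 h).symm⟩
  -- A rank-one update of a diagonal matrix, invertible away from the `dᵢ`.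
  have hmat : scalar ι t - (Matrix.of fun i j => if j = i then d j / 2 else -(d j / 2) : Matrix ι ι ℝ) =
      diagonal (fun i => t - d i) + replicateCol Unit (1 : ι → ℝ) *
        replicateRow Unit (fun j => d j / 2) := by
    ext i j
    by_cases h : i = j
    · subst h
      simp [Matrix.mul_apply]
      ring
    · simp [Matrix.mul_apply, h, Ne.symm h]
  have hu : IsUnit (diagonal fun i => t - d i).det := by
    rw [det_diagonal]
    exact (Finset.prod_ne_zero_iff.2 fun i _ => ht' i).isUnit
  have hinv : (diagonal fun i => t - d i)⁻¹ = diagonal fun i => (t - d i)⁻¹ := by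
    refine inv_eq_right_inv ?_
    rw [diagonal_mul_diagonal, ← diagonal_one]
    congr 1
    ext i
    exact mul_inv_cancel₀ (ht' i)
  have hdet : (1 + replicateRow Unit (fun j => d j / 2) * (diagonal fun i => (t - d i)⁻¹) *
      replicateCol Unit (1 : ι → ℝ)).det = 1 + ∑ i, d i / 2 * (t - d i)⁻¹ := by
    rw [det_unique, Matrix.add_apply, Matrix.mul_apply]
    simp [mul_diagonal]
  simp only [Set.mem_ofPred_eq, eval_mul, eval_ofNat, eval_charpoly]
  rw [hmat, det_add_replicateCol_mul_replicateRow hu, det_diagonal, hinv, hdet,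
    eval_multipartitePoly ht']
  have hsum : 2 * ∑ i, d i / 2 * (t - d i)⁻¹ = ∑ i, d i / (t - d i) := by
    rw [Finset.mul_sum]
    exact Finset.sum_congr rfl fun i _ => by ring
  linear_combination (∏ i, (t - d i)) * hsum

/-- The characteristic polynomial of `S + I` for a complete multipartite graph. -/
lemma charpoly_signMatrix_completeMultipartiteGraph [DecidableEq (Σ i, V i)] :
    X ^ Fintype.card ι * (2 * (completeMultipartiteGraph V).signMatrix.charpoly) =
      X ^ Fintype.card (Σ i, V i) *
        multipartitePoly (fun i => 2 * (Fintype.card (V i) : ℝ)) := by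
  have h : (Matrix.of fun i v => if v.1 = i then 1 else -1 : Matrix ι (Σ i, V i) ℝ) *
      partMatrix V = Matrix.of fun i j => if j = i then 2 * (Fintype.card (V j) : ℝ) / 2
        else -(2 * (Fintype.card (V j) : ℝ) / 2) := by
    ext i j
    simp only [partMatrix, Matrix.mul_apply, of_apply, mul_ite, mul_one, mul_zero]
    rw [Fintype.sum_sigma, Finset.sum_eq_single j (by intro b _ hb; simp [hb]) (by simp)]
    by_cases hij : j = i <;> simp [hij]
  rw [← charpoly_quotient, ← h, mul_left_comm, signMatrix_completeMultipartiteGraph,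
    charpoly_mul_comm']
  ring

end Multipartite

lemma nonempty_iso_completeMultipartiteGraph {ι κ : Type*} [Fintype ι] [Fintype κ]
    (V : ι → Type*) [∀ i, Fintype (V i)] (U : κ → Type*)
    [∀ i, Fintype (U i)]
    (h : Finset.univ.val.map (fun i => Fintype.card (V i)) =
      Finset.univ.val.map (fun i => Fintype.card (U i))) :
    Nonempty (completeMultipartiteGraph V ≃g completeMultipartiteGraph U) := by
  have hc : ∀ c, Nonempty ({i // Fintype.card (V i) = c} ≃ {i // Fintype.card (U i) = c}) := by
    intro c
    refine ⟨Fintype.equivOfCardEq ?_⟩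
    have := congrArg (Multiset.count c) h
    rw [Multiset.count_map, Multiset.count_map] at this
    rw [Fintype.card_subtype, Fintype.card_subtype]
    simpa [Finset.card, eq_comm] using this
  let e : ι ≃ κ := Equiv.ofFiberEquiv (f := fun i => Fintype.card (V i))
    (g := fun j => Fintype.card (U j)) fun c => (hc c).some
  have he : ∀ i, Fintype.card (V i) = Fintype.card (U (e i)) := fun i =>
    (Equiv.ofFiberEquiv_map (f := fun i => Fintype.card (V i))
      (g := fun j => Fintype.card (U j)) _ i).symm
  let f : ∀ i, V i ≃ U (e i) := fun i => Fintype.equivOfCardEq (he i)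
  refine ⟨⟨e.sigmaCongr f, fun {a b} => ?_⟩⟩
  change ¬(e a.1 = e b.1) ↔ ¬(a.1 = b.1)
  rw [e.injective.eq_iff]

/-! ### Recovering the `dᵢ` from `P` -/

section MultipartitePolynomial

variable {ι κ : Type*} [Fintype ι] [Fintype κ]

lemma eval_zero_multipartitePoly_ne_zero {d : ι → ℝ} (hd : ∀ i, d i ≠ 0)
    (hk : Fintype.card ι ≠ 2) : (multipartitePoly d).eval 0 ≠ 0 := by
  have h1 : (Fintype.card ι : ℝ) - 2 ≠ 0 := sub_ne_zero.2 (by exact_mod_cast hk)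
  have h2 : ∏ i, -d i ≠ 0 := Finset.prod_ne_zero_iff.2 fun i _ => neg_ne_zero.2 (hd i)
  simpa [multipartitePoly, eval_prod] using ⟨h1, h2⟩

lemma card_eq_of_X_pow_mul_multipartitePoly_eq {d : ι → ℝ} {d' : κ → ℝ} (hd : ∀ i, d i ≠ 0)
    (hd' : ∀ i, d' i ≠ 0) (hk : 3 ≤ Fintype.card ι)
    (h : X ^ Fintype.card κ * multipartitePoly d = X ^ Fintype.card ι * multipartitePoly d') :
    Fintype.card κ = Fintype.card ι := by
  rcases lt_trichotomy (Fintype.card κ) (Fintype.card ι) with hlt | heq | hgt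
  · obtain ⟨m, hm⟩ := Nat.exists_eq_add_of_lt hlt
    rw [hm, add_assoc, pow_add, mul_assoc] at h
    have := congrArg (eval 0) (mul_left_cancel₀ (pow_ne_zero _ X_ne_zero) h)
    exact absurd (by simpa using this) (eval_zero_multipartitePoly_ne_zero hd (by omega))
  · exact heq
  · obtain ⟨m, hm⟩ := Nat.exists_eq_add_of_lt hgt
    rw [hm, add_assoc, pow_add, mul_assoc] at h
    have := congrArg (eval 0) (mul_left_cancel₀ (pow_ne_zero _ X_ne_zero) h)
    exact absurd (by simpa using this.symm) (eval_zero_multipartitePoly_ne_zero hd' (by omega))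

/-- The difference `D` of the products satisfies `X D' = (k - 2) D`, so only its coefficient of
degree `k - 2` can survive. -/
lemma exists_prod_eq_add_of_multipartitePoly_eq {d : ι → ℝ} {d' : κ → ℝ}
    (hk : 2 ≤ Fintype.card ι) (hc : Fintype.card κ = Fintype.card ι)
    (h : multipartitePoly d = multipartitePoly d') :
    ∃ c : ℝ, ∏ i, (X - C (d i)) = ∏ i, (X - C (d' i)) + C c * X ^ (Fintype.card ι - 2) := by
  set D : ℝ[X] := ∏ i, (X - C (d i)) - ∏ i, (X - C (d' i)) with hD
  have h1 : X * derivative D = C ((Fintype.card ι : ℝ) - 2) * D := by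
    rw [multipartitePoly, multipartitePoly, hc] at h
    rw [hD, derivative_sub, C_sub, C_eq_natCast]
    have : (C 2 : ℝ[X]) = 2 := rfl
    rw [this]
    linear_combination h
  refine ⟨D.coeff (Fintype.card ι - 2), ?_⟩
  rw [← sub_eq_iff_eq_add', ← hD]
  ext m
  rw [coeff_C_mul_X_pow]
  split_ifs with hm
  · rw [hm]
  · have h2 := congrArg (coeff · m) h1
    simp only [coeff_C_mul] at h2
    have h3 : (X * derivative D).coeff m = m * D.coeff m := by
      cases m with
      | zero => simp
      | succ m => rw [coeff_X_mul, coeff_derivative]; push_cast; ring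
    rw [h3] at h2
    have h4 : (m : ℝ) - ((Fintype.card ι : ℝ) - 2) ≠ 0 := by
      intro h5
      have : (m : ℝ) + 2 = Fintype.card ι := by linarith
      have : m + 2 = Fintype.card ι := by exact_mod_cast this
      omega
    exact (mul_eq_zero.1 (by linear_combination h2 :
      ((m : ℝ) - ((Fintype.card ι : ℝ) - 2)) * D.coeff m = 0)).resolve_left h4

lemma sq_dvd_multipartitePoly {d : ι → ℝ} {a : ℝ} {T : Finset ι} (hT : 3 ≤ T.card)
    (ha : ∀ i ∈ T, d i = a) : (X - C a) ^ 2 ∣ multipartitePoly d := by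
  have h : (X - C a) ^ 3 ∣ ∏ i, (X - C (d i)) := by
    refine (pow_dvd_pow _ hT).trans ?_
    rw [← Finset.prod_const, Finset.prod_congr rfl fun i hi => by rw [← ha i hi]]
    exact Finset.prod_dvd_prod_of_subset _ _ _ (Finset.subset_univ T)
  exact dvd_sub ((pow_sub_one_dvd_derivative_of_pow_dvd h).mul_left _)
    (((pow_dvd_pow _ (by norm_num)).trans h).mul_left _)

/-- Otherwise `P = Q g` near `a`, with `g = 2 + ∑ dᵢ / (t - dᵢ)` and `Q(a) ≠ 0`. Then `g(a) = 0`, so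
`P'(a) = Q(a) g'(a)`; this is nonzero because positivity of the `dᵢ` makes `g'(a) < 0`. -/
lemma exists_eq_of_sq_dvd_multipartitePoly [Nonempty ι] {d : ι → ℝ} {a : ℝ}
    (hd : ∀ i, 0 < d i) (h : (X - C a) ^ 2 ∣ multipartitePoly d) : ∃ i, d i = a := by
  by_contra! hne
  have hne' : ∀ i, a - d i ≠ 0 := fun i => sub_ne_zero.2 (hne i).symm
  obtain ⟨R, hR⟩ := h
  have hQ : ∏ i, (a - d i) ≠ 0 := Finset.prod_ne_zero_iff.2 fun i _ => hne' i
  have hev : ∀ᶠ t in nhds a, ∀ i, t - d i ≠ 0 := by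
    rw [Filter.eventually_all]
    intro i
    exact (ContinuousAt.eventually_ne (by fun_prop) (hne' i))
  have hP : HasDerivAt (fun t => (multipartitePoly d).eval t) 0 a := by
    have := (multipartitePoly d).hasDerivAt a
    rwa [show (derivative (multipartitePoly d)).eval a = 0 by
      rw [hR]; simp [derivative_mul, derivative_pow]]
      at this
  have hsum : HasDerivAt (fun t => 2 + ∑ i, d i / (t - d i)) (-∑ i, d i / (a - d i) ^ 2) a := by
    rw [← Finset.sum_neg_distrib]
    refine (HasDerivAt.fun_sum fun i _ => ?_).const_add 2
    have := (hasDerivAt_const a (d i)).fun_div ((hasDerivAt_id a).sub_const (d i)) (hne' i)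
    simpa [neg_div] using this
  have hprod : HasDerivAt (fun t => ∏ i, (t - d i))
      ((derivative (∏ i, (X - C (d i)))).eval a) a := by
    have := (∏ i, (X - C (d i))).hasDerivAt a
    simp only [eval_prod, eval_sub, eval_X, eval_C] at this
    exact this
  have hmul := (hprod.mul hsum).congr_of_eventuallyEq
    (hev.mono fun t ht => eval_multipartitePoly ht)
  have h0 : 2 + ∑ i, d i / (a - d i) = 0 := by
    have h1 := eval_multipartitePoly hne'
    rw [hR] at h1
    simpa [hQ] using h1.symm
  have heq := hP.unique hmul
  rw [h0, mul_zero, zero_add] at heq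
  have hpos : 0 < ∑ i, d i / (a - d i) ^ 2 :=
    Finset.sum_pos (fun i _ => div_pos (hd i) (by have := hne' i; positivity))
      Finset.univ_nonempty
  exact (mul_ne_zero hQ (neg_ne_zero.2 hpos.ne')) heq.symm

lemma roots_prod_X_sub_C_univ (d : ι → ℝ) :
    (∏ i, (X - C (d i))).roots = Finset.univ.val.map d := by
  rw [← roots_multiset_prod_X_sub_C (Finset.univ.val.map d), Multiset.map_map]
  rfl

/-- Positive numbers `dᵢ`, three of which coincide, are determined by their `multipartitePoly`. -/
lemma map_eq_map_of_multipartitePoly_eq {d : ι → ℝ} {d' : κ → ℝ} (hd : ∀ i, 0 < d i)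
    (hd' : ∀ i, 0 < d' i) {a : ℝ} {T : Finset ι} (hT : 3 ≤ T.card) (ha : ∀ i ∈ T, d i = a)
    (h : X ^ Fintype.card κ * multipartitePoly d = X ^ Fintype.card ι * multipartitePoly d') :
    Finset.univ.val.map d = Finset.univ.val.map d' := by
  have hk : 3 ≤ Fintype.card ι := hT.trans (Finset.card_le_univ T)
  have hc := card_eq_of_X_pow_mul_multipartitePoly_eq (fun i => (hd i).ne') (fun i => (hd' i).ne')
    hk h
  rw [hc] at h
  replace h := mul_left_cancel₀ (pow_ne_zero _ X_ne_zero) h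
  obtain ⟨c, hcc⟩ := exists_prod_eq_add_of_multipartitePoly_eq (by omega) hc h
  have : Nonempty κ := Fintype.card_pos_iff.1 (by omega)
  obtain ⟨j, hj⟩ := exists_eq_of_sq_dvd_multipartitePoly hd' (h ▸ sq_dvd_multipartitePoly hT ha)
  obtain ⟨i, hi⟩ : T.Nonempty := Finset.card_pos.1 (by omega)
  have h1 := congrArg (eval a) hcc
  have h2 : ∏ i, (a - d i) = 0 :=
    Finset.prod_eq_zero (Finset.mem_univ i) (sub_eq_zero.2 (ha i hi).symm)
  have h3 : ∏ i, (a - d' i) = 0 :=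
    Finset.prod_eq_zero (Finset.mem_univ j) (sub_eq_zero.2 hj.symm)
  have ha0 : a ≠ 0 := ha i hi ▸ (hd i).ne'
  have hc0 : c = 0 := by
    simpa [eval_prod, h2, h3, ha0] using h1
  rw [hc0, C_0, zero_mul, add_zero] at hcc
  have hroots := congrArg roots hcc
  rwa [roots_prod_X_sub_C_univ, roots_prod_X_sub_C_univ] at hroots

end MultipartitePolynomial

/-- A complete multipartite graph with nonempty parts, three of which have the same size, is
determined by its Seidel spectrum up to switching. -/
theorem sDetermined_completeMultipartiteGraph.{a, b} {ι : Type a} [Fintype ι] {V : ι → Type a}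
    [∀ i, Fintype (V i)] [∀ i, Nonempty (V i)] {T : Finset ι} (hT : 3 ≤ T.card) {m : ℕ}
    (hm : ∀ i ∈ T, Fintype.card (V i) = m) :
    SDetermined.{a, b} (completeMultipartiteGraph V) := by
  classical
  intro W _ H hspec
  have hH := charpoly_signMatrix_eq_of_seidelSpectrum_eq hspec
  obtain ⟨U, hU⟩ := exists_isCompleteMultipartite_seidelSwitch (H := H)
    (hH ▸ card_roots_signMatrix_completeMultipartiteGraph V)
  refine ⟨_, ⟨U, rfl⟩, ?_⟩
  have hcard : Fintype.card W = Fintype.card (Σ i, V i) := by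
    simpa [charpoly_natDegree_eq_dim] using congrArg natDegree hH
  rw [← H.charpoly_signMatrix_seidelSwitch U] at hH
  let Y : Quotient hU.setoid → Type b := fun c => {x // hU.setoid.r c.out x}
  let e : H.seidelSwitch U ≃g completeMultipartiteGraph Y := hU.iso
  have hY : ∀ c, Nonempty (Y c) := fun c => ⟨⟨c.out, hU.setoid.refl _⟩⟩
  rw [charpoly_signMatrix_of_iso e] at hH
  have hV := charpoly_signMatrix_completeMultipartiteGraph V
  have hW := charpoly_signMatrix_completeMultipartiteGraph Y
  rw [← Fintype.card_congr e.toEquiv, hcard, hH] at hW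
  have key : Finset.univ.val.map (fun i => 2 * (Fintype.card (V i) : ℝ)) =
      Finset.univ.val.map (fun i => 2 * (Fintype.card (Y i) : ℝ)) := by
    refine map_eq_map_of_multipartitePoly_eq
      (fun i => mul_pos two_pos (Nat.cast_pos.2 Fintype.card_pos))
      (fun i => mul_pos two_pos (Nat.cast_pos.2 Fintype.card_pos)) hT
      (a := 2 * m) (fun i hi => by rw [hm i hi]) ?_
    -- The extra power of `X` allows the common characteristic polynomial to be eliminated between
    -- `hV` and `hW`.
    refine mul_left_cancel₀ (pow_ne_zero (Fintype.card (Σ i, V i)) X_ne_zero) ?_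
    linear_combination X ^ Fintype.card ι * hW - X ^ Fintype.card (Quotient hU.setoid) * hV
  have hinj : Function.Injective fun k : ℕ => 2 * (k : ℝ) := fun k l h => by
    simpa using h
  have key' : Finset.univ.val.map (fun i => Fintype.card (Y i)) =
      Finset.univ.val.map (fun i => Fintype.card (V i)) := by
    refine Multiset.map_injective hinj ?_
    rw [Multiset.map_map, Multiset.map_map]
    exact key.symm
  obtain ⟨f⟩ := nonempty_iso_completeMultipartiteGraph Y V key'
  exact ⟨e.trans f⟩

end SimpleGraph

theorem mainTheorem1 (s : ℕ) (r n : Fin s → ℕ) (hn : ∀ i, 1 ≤ n i) (hr : ∃ i, 3 ≤ r i) :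
    SimpleGraph.SDetermined.{0, v} (SimpleGraph.repeatedMultipartiteGraph r n) := by
  obtain ⟨i, hi⟩ := hr
  have : ∀ p : (Σ i : Fin s, Fin (r i)), Nonempty (Fin (n p.1)) := fun p => ⟨⟨0, hn p.1⟩⟩
  refine SimpleGraph.sDetermined_completeMultipartiteGraph
    (T := Finset.univ.map (Function.Embedding.sigmaMk i)) (by simpa using hi) (m := n i) ?_
  simp
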